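/- Let $\Sigma$ be a finite set with at least two elements $\mathbf{0}\neq\mathbf{1}$, and let $\Sigma^{<\mathrm{Ord}}$ be the class of all functions $w$ whose domain is an ordinal and whose values lie in $\Sigma$. For a set $x$, let $\mathrm{L}[x]=\bigcup_{\alpha\in\mathrm{Ord}}\mathrm{L}_\alpha[x]$ be the class of sets constructible relative to $x$, where $\mathrm{L}_0[x]=\varnothing$, $\mathrm{L}_{\alpha+1}[x]$ is the set of all subsets of $M=\mathrm{L}_\alpha[x]$ that are first-order definable with parameters over the structure $(M,\in,x\cap M)$, and $\mathrm{L}_\lambda[x]=\bigcup_{\alpha<\lambda}\mathrm{L}_\alpha[x]$ for limit ordinals $\lambda$. Lemma. If $x$ is a set of ordinals and $\Sigma^{<\mathrm{Ord}}\subseteq\mathrm{L}[x]$, then $\mathrm{V}=\mathrm{L}[x]$, where $\mathrm{V}$ is the class of all sets. -/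

import Mathlib

/-!
The universe `V` of all sets is Mathlib's type `ZFSet.{u}`; classes are `Set ZFSet.{u}`;
ordinals as elements of `V` are von Neumann ordinals (`ZFSet.IsOrdinal`).
-/

universe u

namespace RelConstr

/-- Relation symbols of the language `{∈, P}` of set theory with one additional unary predicate. -/
inductive SetRel : ℕ → Type
  | pred : SetRel 1
  | mem : SetRel 2

/-- The first-order language of set theory with one additional unary predicate `P`. -/
abbrev setLang : FirstOrder.Language.{0, 0} where
  Functions := fun _ => Empty
  Relations := SetRel

/-- The structure `(M, ∈, x ∩ M)`. -/
@[reducible] def setStructure (x M : ZFSet.{u}) : setLang.Structure M where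
  funMap := fun f => f.elim
  RelMap := fun r v =>
    match r, v with
    | SetRel.pred, v => (v 0 : ZFSet.{u}) ∈ x
    | SetRel.mem, v => (v 0 : ZFSet.{u}) ∈ (v 1 : ZFSet.{u})

/-- `def_x(M)`: the set of all subsets of `M` that are first-order definable, with parameters
from `M`, over the structure `(M, ∈, x ∩ M)`. -/
noncomputable def definablePowerset (x M : ZFSet.{u}) : ZFSet.{u} :=
  ZFSet.sep
    (fun Y =>
      letI := setStructure x M
      (Set.univ : Set M).Definable₁ setLang {m : M | (m : ZFSet.{u}) ∈ Y})
    M.powerset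

/-- The hierarchy of sets constructible relative to `x`: `L_0[x] = ∅`,
`L_{α+1}[x] = def_x(L_α[x])`, and `L_α[x] = ⋃_{β<α} L_β[x]` for limit ordinals `α`. -/
noncomputable def level (x : ZFSet.{u}) (α : Ordinal.{u}) : ZFSet.{u} :=
  Ordinal.limitRecOn (motive := fun _ => ZFSet.{u}) α
    ∅
    (fun _ M => definablePowerset x M)
    (fun α _ ih => ZFSet.iUnion fun β : Set.Iio α => ih β.1 β.2)

/-- The class `L[x]` of all sets constructible relative to `x`. -/
def L (x : ZFSet.{u}) : Set ZFSet.{u} :=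
  {y | ∃ α : Ordinal.{u}, y ∈ level x α}

/-- The class `S^{<Ord}` of all functions (as sets of Kuratowski pairs) with values in `S` whose
domain is an ordinal. -/
def SeqLtOrd (S : ZFSet.{u}) : Set ZFSet.{u} :=
  {w | ∃ α : ZFSet.{u}, α.IsOrdinal ∧ ZFSet.IsFunc α S w}

end RelConstr

/-! By choice, any set y lies in a transitive set t enumerated as {π(ξ) : ξ < κ}. Membership on t
becomes a relation R on κ, with (ξ, η) in R iff π(ξ) ∈ π(η). Under (ξ, η) ↦ κξ + η, R turns into a
subset of κ·κ, whose characteristic function is a sequence of the allowed kind and so lies in L[x].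

The rest takes place in L[x]. The coding map is the Mostowski collapse of the lexicographic order on
κ × κ (`mem_pairCode`), so its graph is constructible and R can be decoded. The relation R is
well-founded and its collapsing map is π, so π restricted to κ is constructible
(`exists_collapse_graph`), and y is one of its values.

Instead of verifying ZF in L[x], the proof uses one closure principle, `mem_L_of_definable`:
replacement in V puts the relevant sets into a single level, and a definition that works over every
large enough transitive set works over that level. -/

namespace RelConstr

/-! ### Definability over a transitive structure. -/

variable {x M : ZFSet.{u}} {α : Type}

/-- A property of tuples of sets is definable with parameters over `(M, ∈, x ∩ M)`. -/
def DefOver (x M : ZFSet.{u}) {α : Type} (P : (α → ZFSet.{u}) → Prop) : Prop :=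
  letI := setStructure x M
  (Set.univ : Set M).Definable setLang {v : α → M | P fun i => (v i : ZFSet)}

/-- A projection, or a constant function with value in `M`. -/
def IsTerm (M : ZFSet.{u}) {α : Type} (t : (α → ZFSet.{u}) → ZFSet.{u}) : Prop :=
  ∃ i : (Set.univ : Set M) ⊕ α, ∀ v, t v = Sum.elim (fun m => (m.1 : ZFSet)) v i

theorem IsTerm.var (i : α) : IsTerm M (fun v : α → ZFSet.{u} => v i) := ⟨Sum.inr i, fun _ => rfl⟩

theorem IsTerm.const {c : ZFSet.{u}} (hc : c ∈ M) : IsTerm M (fun _ : α → ZFSet.{u} => c) :=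
  ⟨Sum.inl ⟨⟨c, hc⟩, trivial⟩, fun _ => rfl⟩

theorem IsTerm.lift {t : (α → ZFSet.{u}) → ZFSet.{u}} (ht : IsTerm M t) :
    IsTerm M (fun v : α ⊕ Unit → ZFSet.{u} => t fun i => v (Sum.inl i)) := by
  obtain ⟨i | i, hi⟩ := ht
  · exact ⟨Sum.inl i, fun v => by simp [hi]⟩
  · exact ⟨Sum.inr (Sum.inl i), fun v => by simp [hi]⟩

theorem IsTerm.mem {t : (α → ZFSet.{u}) → ZFSet.{u}} (ht : IsTerm M t) {v : α → ZFSet.{u}}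
    (hv : ∀ i, v i ∈ M) : t v ∈ M := by
  obtain ⟨i | i, hi⟩ := ht
  · simp [hi]
  · simpa [hi] using hv i

theorem sumElim_coe (v : α → M) (i : (Set.univ : Set M) ⊕ α) :
    Sum.elim (fun m => (m.1 : ZFSet)) (fun i => (v i : ZFSet)) i =
      ((Sum.elim Subtype.val v i : M) : ZFSet) := by
  cases i <;> rfl

namespace DefOver

variable {P Q : (α → ZFSet.{u}) → Prop}

theorem congr (h : DefOver x M P) (hPQ : ∀ v, (∀ i, v i ∈ M) → (Q v ↔ P v)) :
    DefOver x M Q := by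
  unfold DefOver at *
  convert h using 1
  ext v
  exact hPQ _ fun i => (v i).2

theorem and (hP : DefOver x M P) (hQ : DefOver x M Q) : DefOver x M (fun v => P v ∧ Q v) :=
  letI := setStructure x M
  Set.Definable.inter hP hQ

theorem or (hP : DefOver x M P) (hQ : DefOver x M Q) : DefOver x M (fun v => P v ∨ Q v) :=
  letI := setStructure x M
  Set.Definable.union hP hQ

theorem not (hP : DefOver x M P) : DefOver x M (fun v => ¬ P v) :=
  letI := setStructure x M
  Set.Definable.compl hP

theorem imp (hP : DefOver x M P) (hQ : DefOver x M Q) : DefOver x M (fun v => P v → Q v) :=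
  (hP.not.or hQ).congr fun _ _ => imp_iff_not_or

theorem iff (hP : DefOver x M P) (hQ : DefOver x M Q) : DefOver x M (fun v => P v ↔ Q v) :=
  ((hP.imp hQ).and (hQ.imp hP)).congr fun _ _ => iff_iff_implies_and_implies

theorem ex {Q : (α → ZFSet.{u}) → ZFSet.{u} → Prop}
    (hQ : DefOver x M (fun v : α ⊕ Unit → ZFSet.{u} =>
      Q (fun i => v (Sum.inl i)) (v (Sum.inr ())))) :
    DefOver x M (fun v => ∃ z ∈ M, Q v z) := by
  unfold DefOver at *
  convert Set.Definable.exists_of_finite hQ using 1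
  ext v
  constructor
  · rintro ⟨z, hz, h⟩
    exact ⟨fun _ => ⟨z, hz⟩, h⟩
  · rintro ⟨z, h⟩
    exact ⟨z (), (z ()).2, h⟩

theorem all {Q : (α → ZFSet.{u}) → ZFSet.{u} → Prop}
    (hQ : DefOver x M (fun v : α ⊕ Unit → ZFSet.{u} =>
      Q (fun i => v (Sum.inl i)) (v (Sum.inr ())))) :
    DefOver x M (fun v => ∀ z ∈ M, Q v z) :=
  (ex (Q := fun v z => ¬ Q v z) hQ.not).not.congr fun v _ => by simp

theorem of_formula {P : (α → ZFSet.{u}) → Prop}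
    (φ : setLang.Formula ((Set.univ : Set M) ⊕ α))
    (h : letI := setStructure x M
      ∀ v : α → M, (P fun i => (v i : ZFSet)) ↔ φ.Realize (Sum.elim (↑) v)) :
    DefOver x M P := by
  let := setStructure x M
  exact Set.definable_iff_exists_formula_sum.2 ⟨φ, Set.ext h⟩

variable {s t : (α → ZFSet.{u}) → ZFSet.{u}}

theorem mem (hs : IsTerm M s) (ht : IsTerm M t) : DefOver x M (fun v => s v ∈ t v) := by
  let := setStructure x M
  obtain ⟨i, hi⟩ := hs
  obtain ⟨j, hj⟩ := ht
  refine of_formula (FirstOrder.Language.Relations.formula₂ (L := setLang) SetRel.mem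
    (.var i) (.var j)) fun v => ?_
  rw [hi, hj, sumElim_coe, sumElim_coe, FirstOrder.Language.Formula.realize_rel₂]
  rfl

theorem eq (hs : IsTerm M s) (ht : IsTerm M t) : DefOver x M (fun v => s v = t v) := by
  let := setStructure x M
  obtain ⟨i, hi⟩ := hs
  obtain ⟨j, hj⟩ := ht
  refine of_formula (FirstOrder.Language.Term.equal (.var i) (.var j)) fun v => ?_
  rw [hi, hj, sumElim_coe, sumElim_coe, FirstOrder.Language.Formula.realize_equal]
  exact Subtype.coe_inj

/-- Being a Kuratowski pair is a bounded condition: transitivity of `M` keeps the elements of `r v`,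
and theirs, inside `M`, so relativized quantifiers lose nothing. -/
theorem eq_pair {r : (α → ZFSet.{u}) → ZFSet.{u}} (hM : M.IsTransitive)
    (hr : IsTerm M r) (hs : IsTerm M s) (ht : IsTerm M t) :
    DefOver x M (fun v => r v = ZFSet.pair (s v) (t v)) := by
  have h : DefOver x M (fun v => ∃ a ∈ M, ∃ b ∈ M, a ∈ r v ∧ b ∈ r v ∧
      (∀ q ∈ M, q ∈ r v → q = a ∨ q = b) ∧ (∀ q ∈ M, q ∈ a ↔ q = s v) ∧
      (∀ q ∈ M, q ∈ b ↔ q = s v ∨ q = t v)) := by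
    refine ex (ex (((mem ?_ ?_).and ((mem ?_ ?_).and ((all ((mem ?_ ?_).imp
      ((eq ?_ ?_).or (eq ?_ ?_)))).and ((all ((mem ?_ ?_).iff (eq ?_ ?_))).and
      (all ((mem ?_ ?_).iff ((eq ?_ ?_).or (eq ?_ ?_))))))))))
    all_goals first
      | exact IsTerm.var _
      | exact hr.lift.lift
      | exact hr.lift.lift.lift
      | exact hs.lift.lift.lift
      | exact ht.lift.lift.lift
  refine h.congr fun v hv => ?_
  have hrM := hr.mem hv
  have hsM := hs.mem hv
  have htM := ht.mem hv
  generalize r v = r at *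
  generalize s v = s at *
  generalize t v = t at *
  constructor
  · rintro rfl
    have h1 : ({s} : ZFSet) ∈ M := hM _ hrM (by simp [ZFSet.pair])
    have h2 : ({s, t} : ZFSet) ∈ M := hM _ hrM (by simp [ZFSet.pair])
    exact ⟨_, h1, _, h2, by simp [ZFSet.pair]⟩
  · rintro ⟨a, ha, b, hb, har, hbr, hq, hqa, hqb⟩
    have h1 : a = {s} := by
      ext q
      rw [ZFSet.mem_singleton]
      exact ⟨fun h => (hqa q (hM _ ha h)).1 h, fun h => (hqa q (h ▸ hsM)).2 h⟩
    have h2 : b = {s, t} := by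
      ext q
      rw [ZFSet.mem_pair]
      exact ⟨fun h => (hqb q (hM _ hb h)).1 h,
        fun h => (hqb q (by rcases h with rfl | rfl <;> assumption)).2 h⟩
    subst h1 h2
    ext q
    rw [ZFSet.pair, ZFSet.mem_pair]
    exact ⟨fun h => hq q (hM _ hrM h) h, by rintro (rfl | rfl) <;> assumption⟩

theorem pair_mem {r : (α → ZFSet.{u}) → ZFSet.{u}} (hM : M.IsTransitive)
    (hr : IsTerm M r) (hs : IsTerm M s) (ht : IsTerm M t) :
    DefOver x M (fun v => ZFSet.pair (s v) (t v) ∈ r v) := by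
  have h : DefOver x M (fun v => ∃ p ∈ M, p = ZFSet.pair (s v) (t v) ∧ p ∈ r v) :=
    ex ((eq_pair hM (IsTerm.var _) hs.lift ht.lift).and (mem (IsTerm.var _) hr.lift))
  refine h.congr fun v hv => ⟨fun h => ⟨_, hM _ (hr.mem hv) h, rfl, h⟩, ?_⟩
  rintro ⟨_, _, rfl, h⟩
  exact h

end DefOver

/-! ### Levels of the hierarchy and closure properties of L[x]. -/

theorem mem_of_pair_mem (hM : M.IsTransitive) {a b : ZFSet.{u}} (h : ZFSet.pair a b ∈ M) :
    a ∈ M ∧ b ∈ M := by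
  have h1 : ({a, b} : ZFSet) ∈ M := hM _ h (by simp [ZFSet.pair])
  exact ⟨hM _ h1 (by simp), hM _ h1 (by simp)⟩

theorem mem_definablePowerset {Y : ZFSet.{u}} : Y ∈ definablePowerset x M ↔
    Y ⊆ M ∧ DefOver x M (fun v : Fin 1 → ZFSet.{u} => v 0 ∈ Y) := by
  rw [definablePowerset, ZFSet.mem_sep, ZFSet.mem_powerset]
  rfl

theorem subset_definablePowerset (hM : M.IsTransitive) : M ⊆ definablePowerset x M := fun y hy =>
  mem_definablePowerset.2 ⟨hM y hy, .mem (.var 0) (.const hy)⟩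

theorem self_mem_definablePowerset : M ∈ definablePowerset x M := by
  refine mem_definablePowerset.2 ⟨fun _ h => h, ?_⟩
  have h : DefOver x M (fun v : Fin 1 → ZFSet.{u} => v 0 = v 0) := .eq (.var 0) (.var 0)
  exact h.congr fun v hv => by simp [hv 0]

variable (x) in
theorem level_zero : level x 0 = ∅ := Ordinal.limitRecOn_zero ..

variable (x) in
theorem level_add_one (o : Ordinal.{u}) : level x (o + 1) = definablePowerset x (level x o) :=
  Ordinal.limitRecOn_add_one ..

theorem mem_level_limit {o : Ordinal.{u}} (ho : Order.IsSuccLimit o) {y : ZFSet.{u}} :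
    y ∈ level x o ↔ ∃ b < o, y ∈ level x b := by
  rw [level, Ordinal.limitRecOn_limit _ _ _ _ ho, ZFSet.mem_iUnion]
  exact ⟨fun ⟨b, hb⟩ => ⟨b.1, b.2, hb⟩, fun ⟨b, hb, h⟩ => ⟨⟨b, hb⟩, h⟩⟩

variable (x) in
theorem isTransitive_level (o : Ordinal.{u}) : (level x o).IsTransitive := by
  induction o using Ordinal.limitRecOn with
  | zero => rw [level_zero]; exact ZFSet.isTransitive_empty
  | add_one o ih =>
    rw [level_add_one]
    intro Y hY
    exact fun y hy => subset_definablePowerset ih ((mem_definablePowerset.1 hY).1 hy)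
  | limit o ho ih =>
    intro y hy z hz
    obtain ⟨b, hb, h⟩ := (mem_level_limit ho).1 hy
    exact (mem_level_limit ho).2 ⟨b, hb, ih b hb _ h hz⟩

variable (x) in
theorem level_mono {a b : Ordinal.{u}} (hab : a ≤ b) : level x a ⊆ level x b := by
  induction b using Ordinal.limitRecOn with
  | zero => rw [nonpos_iff_eq_zero.1 hab]
  | add_one b ih =>
    rcases hab.eq_or_lt with rfl | h
    · exact fun _ h => h
    · rw [level_add_one]
      exact fun y hy => subset_definablePowerset (isTransitive_level x b)
        (ih (Order.lt_add_one_iff.1 h) hy)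
  | limit b hb ih =>
    rcases hab.eq_or_lt with rfl | h
    · exact fun _ h => h
    · exact fun y hy => (mem_level_limit hb).2 ⟨a, h, hy⟩

variable (x) in
theorem level_mem_L (o : Ordinal.{u}) : level x o ∈ L x :=
  ⟨o + 1, by rw [level_add_one]; exact self_mem_definablePowerset⟩

theorem mem_L_of_mem {y z : ZFSet.{u}} (hy : y ∈ L x) (hz : z ∈ y) : z ∈ L x :=
  hy.imp fun o ho => isTransitive_level x o _ ho hz

theorem mem_L_of_pair_mem {a b : ZFSet.{u}} (h : ZFSet.pair a b ∈ L x) : a ∈ L x ∧ b ∈ L x := by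
  obtain ⟨o, ho⟩ := h
  have := mem_of_pair_mem (isTransitive_level x o) ho
  exact ⟨⟨o, this.1⟩, ⟨o, this.2⟩⟩

theorem exists_subset_level {ι : Type*} [Small.{u} ι] {f : ι → ZFSet.{u}} (hf : ∀ i, f i ∈ L x) :
    ∃ o, ∀ i, f i ∈ level x o := by
  choose g hg using hf
  exact ⟨⨆ i, g i, fun i => level_mono x (Ordinal.le_iSup g i) (hg i)⟩

/-- A set of constructible sets is constructible if it is definable, with parameters from a
fixed set `c`, over all sufficiently large transitive sets. -/
theorem mem_L_of_definable {s : ZFSet.{u}} (c : ZFSet.{u}) (hc : ∀ z ∈ c, z ∈ L x)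
    (hs : ∀ z ∈ s, z ∈ L x)
    (h : ∀ M : ZFSet.{u}, M.IsTransitive → (∀ z ∈ c, z ∈ M) → (∀ z ∈ s, z ∈ M) →
      DefOver x M (fun v : Fin 1 → ZFSet.{u} => v 0 ∈ s)) : s ∈ L x := by
  obtain ⟨o, ho⟩ := exists_subset_level (x := x) (f := fun z : c => z.1) fun z => hc _ z.2
  obtain ⟨o', ho'⟩ := exists_subset_level (x := x) (f := fun z : s => z.1) fun z => hs _ z.2
  have h1 : ∀ z ∈ c, z ∈ level x (max o o') := fun z hz =>
    level_mono x (le_max_left _ _) (ho ⟨z, hz⟩)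
  have h2 : ∀ z ∈ s, z ∈ level x (max o o') := fun z hz =>
    level_mono x (le_max_right _ _) (ho' ⟨z, hz⟩)
  refine ⟨max o o' + 1, ?_⟩
  rw [level_add_one, mem_definablePowerset]
  exact ⟨h2, h _ (isTransitive_level x _) h1 h2⟩

theorem pair_mem_L {a b : ZFSet.{u}} (ha : a ∈ L x) (hb : b ∈ L x) : ZFSet.pair a b ∈ L x := by
  have key : ∀ {a b : ZFSet.{u}}, a ∈ L x → b ∈ L x → ({a, b} : ZFSet) ∈ L x := by
    intro a b ha hb
    have hab : ∀ z ∈ ({a, b} : ZFSet), z ∈ L x := by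
      intro z hz
      rcases ZFSet.mem_pair.1 hz with rfl | rfl <;> assumption
    refine mem_L_of_definable {a, b} hab hab fun M hM hc hs => ?_
    refine DefOver.congr (((DefOver.eq (.var 0) (.const (hc a (by simp)))).or
      (DefOver.eq (.var 0) (.const (hc b (by simp)))))) fun v _ => by simp
  -- A Kuratowski pair is two nested unordered pairs, the inner singleton being {a, a}.
  have h := key (key ha ha) (key ha hb)
  rwa [ZFSet.pair_eq_singleton] at h

end RelConstr

/-! ### Mostowski collapse inside L[x]. -/

namespace RelConstr

variable {x M R : ZFSet.{u}} {α : Type}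

/-- A partial solution of the recursion `π b = {π a | (a, b) ∈ R}` whose domain is closed under
`R`-predecessors. -/
def IsAttempt (R f : ZFSet.{u}) : Prop :=
  ∀ b z, ZFSet.pair b z ∈ f → (∀ a, ZFSet.pair a b ∈ R → ∃ y ∈ z, ZFSet.pair a y ∈ f) ∧
    ∀ y ∈ z, ∃ a, ZFSet.pair a b ∈ R ∧ ZFSet.pair a y ∈ f

theorem DefOver.isAttempt {t : (α → ZFSet.{u}) → ZFSet.{u}} (hM : M.IsTransitive) (hR : R ∈ M)
    (ht : IsTerm M t) : DefOver x M (fun v => IsAttempt R (t v)) := by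
  have h : DefOver x M (fun v => ∀ b ∈ M, ∀ z ∈ M, ZFSet.pair b z ∈ t v →
      (∀ a ∈ M, ZFSet.pair a b ∈ R → ∃ y ∈ M, y ∈ z ∧ ZFSet.pair a y ∈ t v) ∧
      ∀ y ∈ M, y ∈ z → ∃ a ∈ M, ZFSet.pair a b ∈ R ∧ ZFSet.pair a y ∈ t v) := by
    refine all (all ((pair_mem hM ?_ ?_ ?_).imp
      ((all ((pair_mem hM ?_ ?_ ?_).imp (ex ((mem ?_ ?_).and (pair_mem hM ?_ ?_ ?_))))).and
      (all ((mem ?_ ?_).imp (ex ((pair_mem hM ?_ ?_ ?_).and (pair_mem hM ?_ ?_ ?_))))))))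
    all_goals first
      | exact IsTerm.var _
      | exact IsTerm.const hR
      | exact ht.lift.lift
      | exact ht.lift.lift.lift.lift
  refine h.congr fun v hv => ?_
  have htM := ht.mem hv
  generalize t v = f at *
  have hf : ∀ {a b}, ZFSet.pair a b ∈ f → a ∈ M ∧ b ∈ M := fun h =>
    mem_of_pair_mem hM (hM _ htM h)
  constructor
  · intro h b _ z hz hbz
    refine ⟨fun a _ hab => ?_, fun y _ hy => ?_⟩
    · obtain ⟨y, hy, h'⟩ := (h b z hbz).1 a hab
      exact ⟨y, hM _ hz hy, hy, h'⟩
    · obtain ⟨a, hab, h'⟩ := (h b z hbz).2 y hy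
      exact ⟨a, (hf h').1, hab, h'⟩
  · intro h b z hbz
    have h' := h b (hf hbz).1 z (hf hbz).2 hbz
    refine ⟨fun a hab => ?_, fun y hy => ?_⟩
    · obtain ⟨y, _, hy⟩ := h'.1 a (mem_of_pair_mem hM (hM _ hR hab)).1 hab
      exact ⟨y, hy⟩
    · obtain ⟨a, _, ha⟩ := h'.2 y (hM _ (hf hbz).2 hy) hy
      exact ⟨a, ha⟩

section Collapse

variable {π : ZFSet.{u} → ZFSet.{u}}

/-- The recursion equation makes `R` well-founded: (a, b) ∈ `R` gives `π a ∈ π b`, so ∈-induction on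
`π b` applies. Attempts are therefore single-valued although the definition does not ask for it. -/
theorem IsAttempt.eq (hπ : ∀ b z, z ∈ π b ↔ ∃ a, ZFSet.pair a b ∈ R ∧ z = π a) {f : ZFSet.{u}}
    (hf : IsAttempt R f) (b : ZFSet.{u}) : ∀ z, ZFSet.pair b z ∈ f → z = π b := by
  induction b using (InvImage.wf π ZFSet.mem_wf).induction with
  | _ b ih =>
    intro z hz
    have ih : ∀ a, ZFSet.pair a b ∈ R → ∀ z, ZFSet.pair a z ∈ f → z = π a := fun a ha =>
      ih a ((hπ b _).2 ⟨a, ha, rfl⟩)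
    ext y
    rw [hπ]
    constructor
    · intro hy
      obtain ⟨a, hab, ha⟩ := (hf b z hz).2 y hy
      exact ⟨a, hab, ih a hab y ha⟩
    · rintro ⟨a, hab, rfl⟩
      obtain ⟨y, hy, ha⟩ := (hf b z hz).1 a hab
      rwa [← ih a hab y ha]

/-- The pairs belonging to some attempt in `c`. -/
noncomputable def attemptUnion (R c : ZFSet.{u}) : ZFSet.{u} :=
  (ZFSet.sUnion c).sep fun p => ∃ f ∈ c, IsAttempt R f ∧ p ∈ f

theorem mem_attemptUnion {c p : ZFSet.{u}} :
    p ∈ attemptUnion R c ↔ ∃ f ∈ c, IsAttempt R f ∧ p ∈ f := by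
  rw [attemptUnion, ZFSet.mem_sep, ZFSet.mem_sUnion]
  exact ⟨And.right, fun h => ⟨h.imp fun f hf => ⟨hf.1, hf.2.2⟩, h⟩⟩

/-- Both clauses only demand that certain pairs be present, so they survive enlarging the attempt.
-/
theorem isAttempt_attemptUnion (c : ZFSet.{u}) : IsAttempt R (attemptUnion R c) := by
  intro b z hbz
  obtain ⟨f, hfc, hf, hbz⟩ := mem_attemptUnion.1 hbz
  refine ⟨fun a hab => ?_, fun y hy => ?_⟩
  · obtain ⟨y, hy, h⟩ := (hf b z hbz).1 a hab
    exact ⟨y, hy, mem_attemptUnion.2 ⟨f, hfc, hf, h⟩⟩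
  · obtain ⟨a, hab, h⟩ := (hf b z hbz).2 y hy
    exact ⟨a, hab, mem_attemptUnion.2 ⟨f, hfc, hf, h⟩⟩

theorem attemptUnion_mem_L {c : ZFSet.{u}} (hR : R ∈ L x) (hc : c ∈ L x) :
    attemptUnion R c ∈ L x := by
  refine mem_L_of_definable {R, c} (by simp [hR, hc]) (fun p hp => ?_) fun M hM hRc _ => ?_
  · obtain ⟨f, hfc, -, hp⟩ := mem_attemptUnion.1 hp
    exact mem_L_of_mem (mem_L_of_mem hc hfc) hp
  · have hRM : R ∈ M := hRc R (by simp)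
    have hcM : c ∈ M := hRc c (by simp)
    have h : DefOver x M (fun v : Fin 1 → ZFSet => ∃ f ∈ M, f ∈ c ∧ IsAttempt R f ∧ v 0 ∈ f) :=
      .ex ((DefOver.mem (.var _) (.const hcM)).and
        ((DefOver.isAttempt hM hRM (.var _)).and (.mem (.var _) (.var _))))
    refine h.congr fun v _ => ?_
    rw [mem_attemptUnion]
    exact ⟨fun ⟨f, hf⟩ => ⟨f, hM _ hcM hf.1, hf⟩, fun ⟨f, _, hf⟩ => ⟨f, hf⟩⟩

/-- By induction on `π b`, the predecessors of `b` are covered by constructible attempts. Their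
union defines `π b`, and adjoining the pair (b, π b) gives an attempt at `b`. -/
theorem exists_isAttempt (hR : R ∈ L x)
    (hπ : ∀ b z, z ∈ π b ↔ ∃ a, ZFSet.pair a b ∈ R ∧ z = π a) (b : ZFSet.{u}) :
    b ∈ L x → ∃ f ∈ L x, IsAttempt R f ∧ ZFSet.pair b (π b) ∈ f := by
  induction b using (InvImage.wf π ZFSet.mem_wf).induction with
  | _ b ih =>
    intro hb
    have ih : ∀ a : {a // ZFSet.pair a b ∈ R}, ∃ f ∈ L x, IsAttempt R f ∧
        ZFSet.pair a.1 (π a) ∈ f := fun a =>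
      ih a ((hπ b _).2 ⟨a, a.2, rfl⟩) (mem_L_of_pair_mem (mem_L_of_mem hR a.2)).1
    choose f hfL hf hfa using ih
    have : Small.{u} {a // ZFSet.pair a b ∈ R} :=
      small_of_injective (β := R) (f := fun a => ⟨ZFSet.pair a.1 b, a.2⟩) fun a a' h =>
        Subtype.ext (ZFSet.pair_injective (Subtype.mk.inj h)).1
    obtain ⟨o, ho⟩ := exists_subset_level hfL
    -- The chosen family `f` need not be constructible, so all attempts in a level containing it are
    -- united.
    let G := attemptUnion R (level x o)
    have hG : IsAttempt R G := isAttempt_attemptUnion _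
    have hGL : G ∈ L x := attemptUnion_mem_L hR (level_mem_L x o)
    have haG : ∀ a, ZFSet.pair a b ∈ R → ZFSet.pair a (π a) ∈ G := fun a ha =>
      mem_attemptUnion.2 ⟨f ⟨a, ha⟩, ho _, hf _, hfa _⟩
    have hπb : π b ∈ L x := by
      refine mem_L_of_definable {R, G, b} (by simp [hR, hGL, hb]) (fun z hz => ?_)
        fun M hM hc _ => ?_
      · obtain ⟨a, hab, rfl⟩ := (hπ b z).1 hz
        exact (mem_L_of_pair_mem (mem_L_of_mem hGL (haG a hab))).2
      · have hRM : R ∈ M := hc R (by simp)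
        have hGM : G ∈ M := hc G (by simp)
        have hbM : b ∈ M := hc b (by simp)
        have h : DefOver x M (fun v : Fin 1 → ZFSet => ∃ a ∈ M, ZFSet.pair a b ∈ R ∧
            ZFSet.pair a (v 0) ∈ G) :=
          .ex ((DefOver.pair_mem hM (.const hRM) (.var _) (.const hbM)).and
            (.pair_mem hM (.const hGM) (.var _) (.var _)))
        refine h.congr fun v _ => ?_
        rw [hπ]
        constructor
        · rintro ⟨a, hab, hva⟩
          exact ⟨a, (mem_of_pair_mem hM (hM _ hRM hab)).1, hab, hva ▸ haG a hab⟩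
        · rintro ⟨a, _, hab, hva⟩
          exact ⟨a, hab, hG.eq hπ a _ hva⟩
    have hp := pair_mem_L hb hπb
    have hmem : ∀ p, p ∈ insert (ZFSet.pair b (π b)) G ↔ p = ZFSet.pair b (π b) ∨ p ∈ G :=
      fun p => ZFSet.mem_insert_iff
    refine ⟨insert (ZFSet.pair b (π b)) G, ?_, ?_, (hmem _).2 (.inl rfl)⟩
    · refine mem_L_of_definable {ZFSet.pair b (π b), G} (by simp [hp, hGL]) (fun z hz => ?_)
        fun M hM hc _ => ?_
      · rcases (hmem z).1 hz with rfl | hz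
        · exact hp
        · exact mem_L_of_mem hGL hz
      · exact ((DefOver.eq (.var 0) (.const (hc (ZFSet.pair b (π b)) (by simp)))).or
          (DefOver.mem (.var 0) (.const (hc G (by simp))))).congr fun v _ => hmem _
    · intro b' z hz
      rcases (hmem _).1 hz with h | h
      · obtain ⟨rfl, rfl⟩ := ZFSet.pair_injective h
        refine ⟨fun a hab => ⟨π a, (hπ _ _).2 ⟨a, hab, rfl⟩, (hmem _).2 (.inr (haG a hab))⟩,
          fun y hy => ?_⟩
        obtain ⟨a, hab, rfl⟩ := (hπ _ y).1 hy
        exact ⟨a, hab, (hmem _).2 (.inr (haG a hab))⟩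
      · refine ⟨fun a hab => ?_, fun y hy => ?_⟩
        · obtain ⟨y, hy, h'⟩ := (hG b' z h).1 a hab
          exact ⟨y, hy, (hmem _).2 (.inr h')⟩
        · obtain ⟨a, hab, h'⟩ := (hG b' z h).2 y hy
          exact ⟨a, hab, (hmem _).2 (.inr h')⟩

/-- Mostowski collapse inside `L[x]`: the restriction to a constructible set of the collapsing map
of a constructible relation is constructible. -/
theorem exists_collapse_graph {D : ZFSet.{u}} (hR : R ∈ L x) (hD : D ∈ L x)
    (hπ : ∀ b z, z ∈ π b ↔ ∃ a, ZFSet.pair a b ∈ R ∧ z = π a) :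
    ∃ G ∈ L x, ∀ b z, ZFSet.pair b z ∈ G ↔ b ∈ D ∧ z = π b := by
  have h : ∀ b : D, ∃ f ∈ L x, IsAttempt R f ∧ ZFSet.pair b.1 (π b) ∈ f := fun b =>
    exists_isAttempt hR hπ b (mem_L_of_mem hD b.2)
  choose f hfL hf hfb using h
  obtain ⟨o, ho⟩ := exists_subset_level hfL
  let U := attemptUnion R (level x o)
  have hU : IsAttempt R U := isAttempt_attemptUnion _
  have hUL : U ∈ L x := attemptUnion_mem_L hR (level_mem_L x o)
  let G := U.sep fun p => ∃ b ∈ D, ∃ z, p = ZFSet.pair b z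
  have hG : ∀ p, p ∈ G ↔ p ∈ U ∧ ∃ b ∈ D, ∃ z, p = ZFSet.pair b z := fun p => ZFSet.mem_sep
  refine ⟨G, ?_, fun b z => ?_⟩
  · refine mem_L_of_definable {U, D} (by simp [hUL, hD])
      (fun p hp => mem_L_of_mem hUL ((hG p).1 hp).1) fun M hM hc _ => ?_
    have hUM : U ∈ M := hc U (by simp)
    have hDM : D ∈ M := hc D (by simp)
    have h : DefOver x M (fun v : Fin 1 → ZFSet => v 0 ∈ U ∧
        ∃ b ∈ M, b ∈ D ∧ ∃ z ∈ M, v 0 = ZFSet.pair b z) :=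
      (DefOver.mem (.var _) (.const hUM)).and (.ex ((DefOver.mem (.var _) (.const hDM)).and
        (.ex (.eq_pair hM (.var _) (.var _) (.var _)))))
    refine h.congr fun v hv => ?_
    rw [hG]
    refine and_congr_right fun _ => ⟨?_, fun ⟨b, _, hb, z, _, h⟩ => ⟨b, hb, z, h⟩⟩
    rintro ⟨b, hb, z, h⟩
    exact ⟨b, hM _ hDM hb, hb, z, (mem_of_pair_mem hM (h ▸ hv 0)).2, h⟩
  · rw [hG]
    constructor
    · rintro ⟨hbz, b', hb', z', h⟩
      obtain ⟨rfl, rfl⟩ := ZFSet.pair_injective h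
      exact ⟨hb', hU.eq hπ _ _ hbz⟩
    · rintro ⟨hb, rfl⟩
      exact ⟨mem_attemptUnion.2 ⟨f ⟨b, hb⟩, ho _, hf _, hfb _⟩, b, hb, _, rfl⟩

end Collapse

end RelConstr

/-! ### Coding pairs of ordinals, and enumerating sets. -/

namespace RelConstr

variable {x : ZFSet.{u}}

theorem mul_add_lt_iff {κ ξ η ξ' η' : Ordinal.{u}} (hη : η < κ) (hη' : η' < κ) :
    κ * ξ' + η' < κ * ξ + η ↔ ξ' < ξ ∨ ξ' = ξ ∧ η' < η := by
  have key : ∀ {ξ η ξ' η' : Ordinal.{u}}, η' < κ → ξ' < ξ → κ * ξ' + η' < κ * ξ + η := by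
    intro ξ η ξ' η' hη' h
    calc κ * ξ' + η' < κ * ξ' + κ := by gcongr
      _ = κ * (ξ' + 1) := by rw [mul_add, mul_one]
      _ ≤ κ * ξ := by gcongr; exact Order.add_one_le_of_lt h
      _ ≤ κ * ξ + η := le_self_add
  rcases lt_trichotomy ξ' ξ with h | rfl | h
  · simp [h, key hη' h]
  · simp
  · simp [h.not_gt, h.ne', (key (η := η') hη h).le]

theorem mul_add_inj {κ ξ η ξ' η' : Ordinal.{u}} (hη : η < κ) (hη' : η' < κ)
    (h : κ * ξ' + η' = κ * ξ + η) : ξ' = ξ ∧ η' = η := by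
  have h1 := (mul_add_lt_iff (ξ := ξ) (ξ' := ξ') hη hη').not.1 h.not_lt
  have h2 := (mul_add_lt_iff (ξ := ξ') (ξ' := ξ) hη' hη).not.1 h.not_gt
  have h3 : ξ' = ξ := le_antisymm (not_lt.1 fun h => h2 (.inl h)) (not_lt.1 fun h => h1 (.inl h))
  subst h3
  exact ⟨rfl, by simpa using h⟩

theorem prod_mem_L {a : ZFSet.{u}} (ha : a ∈ L x) : ZFSet.prod a a ∈ L x := by
  refine mem_L_of_definable {a} (by simp [ha]) (fun p hp => ?_) fun M hM hc _ => ?_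
  · obtain ⟨b, hb, c, hc, rfl⟩ := ZFSet.mem_prod.1 hp
    exact pair_mem_L (mem_L_of_mem ha hb) (mem_L_of_mem ha hc)
  · have haM : a ∈ M := hc a (by simp)
    have h : DefOver x M (fun v : Fin 1 → ZFSet => ∃ b ∈ M, ∃ c ∈ M, b ∈ a ∧ c ∈ a ∧
        v 0 = ZFSet.pair b c) :=
      .ex (.ex ((DefOver.mem (.var _) (.const haM)).and ((DefOver.mem (.var _) (.const haM)).and
        (.eq_pair hM (.var _) (.var _) (.var _)))))
    refine h.congr fun v _ => ?_
    rw [ZFSet.mem_prod]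
    exact ⟨fun ⟨b, hb, c, hc, h⟩ => ⟨b, hM _ haM hb, c, hM _ haM hc, hb, hc, h⟩,
      fun ⟨b, _, c, _, hb, hc, h⟩ => ⟨b, hb, c, hc, h⟩⟩

/-- The lexicographic order on `a × a` induced by `∈`. -/
noncomputable def lexRel (a : ZFSet.{u}) : ZFSet.{u} :=
  (ZFSet.prod (ZFSet.prod a a) (ZFSet.prod a a)).sep fun p => ∃ b c d e,
    p = ZFSet.pair (ZFSet.pair b c) (ZFSet.pair d e) ∧ (b ∈ d ∨ b = d ∧ c ∈ e)

theorem pair_mem_lexRel {a b c d e : ZFSet.{u}} :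
    ZFSet.pair (ZFSet.pair b c) (ZFSet.pair d e) ∈ lexRel a ↔
      ((b ∈ a ∧ c ∈ a) ∧ d ∈ a ∧ e ∈ a) ∧ (b ∈ d ∨ b = d ∧ c ∈ e) := by
  rw [lexRel, ZFSet.mem_sep, ZFSet.pair_mem_prod, ZFSet.pair_mem_prod, ZFSet.pair_mem_prod]
  refine and_congr_right fun _ => ⟨?_, fun h => ⟨b, c, d, e, rfl, h⟩⟩
  rintro ⟨b', c', d', e', h, h'⟩
  simp only [ZFSet.pair_inj] at h
  obtain ⟨⟨rfl, rfl⟩, rfl, rfl⟩ := h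
  exact h'

theorem lexRel_mem_L {a : ZFSet.{u}} (ha : a ∈ L x) : lexRel a ∈ L x := by
  have hP := prod_mem_L (prod_mem_L ha)
  refine mem_L_of_definable {ZFSet.prod (ZFSet.prod a a) (ZFSet.prod a a)} (by simp [hP])
    (fun p hp => mem_L_of_mem hP (ZFSet.mem_sep.1 hp).1) fun M hM hc _ => ?_
  have h : DefOver x M (fun v : Fin 1 → ZFSet =>
      v 0 ∈ ZFSet.prod (ZFSet.prod a a) (ZFSet.prod a a) ∧
      ∃ b ∈ M, ∃ c ∈ M, ∃ d ∈ M, ∃ e ∈ M, ∃ p ∈ M, ∃ q ∈ M, v 0 = ZFSet.pair p q ∧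
        p = ZFSet.pair b c ∧ q = ZFSet.pair d e ∧ (b ∈ d ∨ b = d ∧ c ∈ e)) := by
    refine (DefOver.mem (.var _) (.const (hc _ (by simp)))).and
      (.ex (.ex (.ex (.ex (.ex (.ex ((DefOver.eq_pair hM ?_ ?_ ?_).and
      ((DefOver.eq_pair hM ?_ ?_ ?_).and ((DefOver.eq_pair hM ?_ ?_ ?_).and
      ((DefOver.mem ?_ ?_).or ((DefOver.eq ?_ ?_).and (DefOver.mem ?_ ?_)))))))))))) <;>
    exact IsTerm.var _
  refine h.congr fun v hv => ?_
  rw [lexRel, ZFSet.mem_sep]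
  refine and_congr_right fun _ => ⟨?_, ?_⟩
  · rintro ⟨b, c, d, e, h, h'⟩
    obtain ⟨hp, hq⟩ := mem_of_pair_mem hM (h ▸ hv 0)
    obtain ⟨hb, hc⟩ := mem_of_pair_mem hM hp
    obtain ⟨hd, he⟩ := mem_of_pair_mem hM hq
    exact ⟨b, hb, c, hc, d, hd, e, he, _, hp, _, hq, h, rfl, rfl, h'⟩
  · rintro ⟨b, _, c, _, d, _, e, _, _, _, _, _, h, rfl, rfl, h'⟩
    exact ⟨b, c, d, e, h, h'⟩

open Classical in
/-- The map `(ξ, η) ↦ κ * ξ + η` on pairs of von Neumann ordinals below `κ`. -/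
noncomputable def pairCode (κ : Ordinal.{u}) (p : ZFSet.{u}) : ZFSet.{u} :=
  if h : ∃ q : Ordinal.{u} × Ordinal.{u}, q.1 < κ ∧ q.2 < κ ∧
    p = ZFSet.pair q.1.toZFSet q.2.toZFSet
  then (κ * h.choose.1 + h.choose.2).toZFSet else ∅

theorem pairCode_pair {κ ξ η : Ordinal.{u}} (hξ : ξ < κ) (hη : η < κ) :
    pairCode κ (ZFSet.pair ξ.toZFSet η.toZFSet) = (κ * ξ + η).toZFSet := by
  have h : ∃ q : Ordinal.{u} × Ordinal.{u}, q.1 < κ ∧ q.2 < κ ∧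
    ZFSet.pair ξ.toZFSet η.toZFSet = ZFSet.pair q.1.toZFSet q.2.toZFSet := ⟨(ξ, η), hξ, hη, rfl⟩
  obtain ⟨h1, h2⟩ := ZFSet.pair_injective h.choose_spec.2.2
  rw [pairCode, dif_pos h, ← Ordinal.toZFSet_injective h1, ← Ordinal.toZFSet_injective h2]

/-- Division with remainder by κ shows that the codes below κξ + η are exactly those of the
lexicographic predecessors of (ξ, η). This is the recursion needed to collapse `lexRel`. -/
theorem mem_pairCode (κ : Ordinal.{u}) (b z : ZFSet.{u}) :
    z ∈ pairCode κ b ↔ ∃ a, ZFSet.pair a b ∈ lexRel κ.toZFSet ∧ z = pairCode κ a := by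
  by_cases hb : ∃ q : Ordinal.{u} × Ordinal.{u}, q.1 < κ ∧ q.2 < κ ∧
    b = ZFSet.pair q.1.toZFSet q.2.toZFSet
  · obtain ⟨⟨ξ, η⟩, hξ, hη, rfl⟩ := hb
    dsimp only at hξ hη ⊢
    rw [pairCode_pair hξ hη, Ordinal.mem_toZFSet_iff]
    constructor
    · rintro ⟨ζ, hζ, rfl⟩
      have hκ : κ ≠ 0 := (pos_of_gt hξ).ne'
      have hdiv := Ordinal.div_add_mod ζ κ
      have hmod := Ordinal.mod_lt ζ hκ
      have hlex := hζ
      rw [← hdiv, mul_add_lt_iff hη hmod] at hlex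
      have hlt : ζ / κ < κ := lt_of_le_of_lt (by rcases hlex with h | h; exacts [h.le, h.1.le]) hξ
      refine ⟨ZFSet.pair (ζ / κ).toZFSet (ζ % κ).toZFSet, ?_, ?_⟩
      · rw [pair_mem_lexRel]
        simp only [Ordinal.toZFSet_mem_toZFSet_iff, Ordinal.toZFSet_injective.eq_iff]
        exact ⟨⟨⟨hlt, hmod⟩, hξ, hη⟩, hlex⟩
      · rw [pairCode_pair hlt hmod, hdiv]
    · rintro ⟨a, ha, rfl⟩
      have ha' := ha
      rw [lexRel, ZFSet.mem_sep, ZFSet.pair_mem_prod] at ha'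
      obtain ⟨c, hc, d, hd, rfl⟩ := ZFSet.mem_prod.1 ha'.1.1
      obtain ⟨ξ', hξ', rfl⟩ := Ordinal.mem_toZFSet_iff.1 hc
      obtain ⟨η', hη', rfl⟩ := Ordinal.mem_toZFSet_iff.1 hd
      refine ⟨_, ?_, (pairCode_pair hξ' hη').symm⟩
      rw [pair_mem_lexRel] at ha
      simp only [Ordinal.toZFSet_mem_toZFSet_iff, Ordinal.toZFSet_injective.eq_iff] at ha
      exact (mul_add_lt_iff hη hη').2 ha.2
  -- Outside κ × κ there are no predecessors, which agrees with the default value ∅.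
  · rw [pairCode, dif_neg hb]
    refine iff_of_false (ZFSet.notMem_empty z) ?_
    rintro ⟨a, ha, -⟩
    rw [lexRel, ZFSet.mem_sep, ZFSet.pair_mem_prod] at ha
    obtain ⟨c, hc, d, hd, rfl⟩ := ZFSet.mem_prod.1 ha.1.2
    obtain ⟨ξ, hξ, rfl⟩ := Ordinal.mem_toZFSet_iff.1 hc
    obtain ⟨η, hη, rfl⟩ := Ordinal.mem_toZFSet_iff.1 hd
    exact hb ⟨(ξ, η), hξ, hη, rfl⟩

/-- Every class of ordinals below `o` is coded by a function `w : o → S` in `L[x]`. -/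
theorem exists_seq_mem_L {S zero one : ZFSet.{u}} (hzero : zero ∈ S) (hone : one ∈ S)
    (hne : zero ≠ one) (h : SeqLtOrd S ⊆ L x) (o : Ordinal.{u}) (p : ZFSet.{u} → Prop) :
    ∃ w ∈ L x, (∀ z ∈ o.toZFSet, ∃ s, ZFSet.pair z s ∈ w) ∧
      ∀ z, ZFSet.pair z one ∈ w ↔ z ∈ o.toZFSet ∧ p z := by
  classical
  let w := (ZFSet.prod o.toZFSet S).sep fun q => ∃ z, q = ZFSet.pair z (if p z then one else zero)
  have hw : ∀ z s, ZFSet.pair z s ∈ w ↔ z ∈ o.toZFSet ∧ s = if p z then one else zero := by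
    intro z s
    simp only [w, ZFSet.mem_sep, ZFSet.pair_mem_prod, ZFSet.pair_inj]
    constructor
    · rintro ⟨⟨hz, -⟩, _, rfl, hs⟩
      exact ⟨hz, hs⟩
    · rintro ⟨hz, rfl⟩
      exact ⟨⟨hz, by split_ifs <;> assumption⟩, z, rfl, rfl⟩
  refine ⟨w, h ⟨o.toZFSet, ZFSet.isOrdinal_toZFSet o, ZFSet.sep_subset, fun z hz => ?_⟩,
    fun z hz => ⟨_, (hw z _).2 ⟨hz, rfl⟩⟩, fun z => ?_⟩
  · exact ⟨_, (hw z _).2 ⟨hz, rfl⟩, fun s hs => ((hw z s).1 hs).2⟩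
  · rw [hw]
    by_cases hp : p z <;> simp [hp, hne.symm]

/-- Every set belongs to a transitive set enumerated by an ordinal. -/
theorem exists_enumeration (y : ZFSet.{u}) : ∃ (κ : Ordinal.{u}) (π : ZFSet.{u} → ZFSet.{u}),
    (∃ b ∈ κ.toZFSet, π b = y) ∧
    ∀ b z, z ∈ π b ↔ b ∈ κ.toZFSet ∧ ∃ a ∈ κ.toZFSet, π a ∈ π b ∧ z = π a := by
  classical
  let t := ZFSet.vonNeumann (Order.succ y.rank)
  have ht : t.IsTransitive := ZFSet.isTransitive_vonNeumann _
  let r : Shrink.{u} t → Shrink.{u} t → Prop := WellOrderingRel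
  -- A von Neumann ordinal is its own rank, so the rank of `b` serves as its index.
  let e : ZFSet.{u} → ZFSet.{u} := fun b =>
    if hb : b.rank < Ordinal.type r then ((equivShrink t).symm (Ordinal.enum r ⟨b.rank, hb⟩)).1
    else ∅
  have he : ∀ z ∈ t, ∃ b ∈ (Ordinal.type r).toZFSet, e b = z := by
    intro z hz
    refine ⟨(Ordinal.typein r (equivShrink t ⟨z, hz⟩)).toZFSet,
      Ordinal.toZFSet_mem_toZFSet_iff.2 (Ordinal.typein_lt_type r _), ?_⟩
    simp [e, Ordinal.typein_lt_type]
  -- `e` depends only on rank and may be nonempty at non-ordinals. Cutting it off outside κ makes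
  -- the recursion for `π` hold at every set.
  let π : ZFSet.{u} → ZFSet.{u} := fun b => if b ∈ (Ordinal.type r).toZFSet then e b else ∅
  have hπ : ∀ b ∈ (Ordinal.type r).toZFSet, π b = e b := fun b hb => if_pos hb
  have hπt : ∀ b ∈ (Ordinal.type r).toZFSet, π b ∈ t := by
    intro b hb
    rw [hπ b hb]
    obtain ⟨o, ho, rfl⟩ := Ordinal.mem_toZFSet_iff.1 hb
    simp only [e, Ordinal.rank_toZFSet, dif_pos ho]
    exact Subtype.property _
  refine ⟨Ordinal.type r, π, ?_, fun b z => ⟨fun hz => ?_, ?_⟩⟩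
  · obtain ⟨b, hb, h⟩ := he y (ZFSet.mem_vonNeumann_succ y)
    exact ⟨b, hb, (hπ b hb).trans h⟩
  · have hb : b ∈ (Ordinal.type r).toZFSet := by
      by_contra hb
      simp only [π, if_neg hb] at hz
      exact ZFSet.notMem_empty z hz
    obtain ⟨a, ha, rfl⟩ := he z (ht _ (hπt b hb) hz)
    exact ⟨hb, a, ha, by rwa [hπ a ha], (hπ a ha).symm⟩
  · rintro ⟨_, a, _, h, rfl⟩
    exact h

end RelConstr

/-! ### Decoding an arbitrary set in L[x]. -/

open RelConstr in
theorem lemma6p5 (S zero one : ZFSet.{u}) (hfin : (S : Set ZFSet.{u}).Finite)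
    (hzero : zero ∈ S) (hone : one ∈ S) (hne : zero ≠ one)
    (x : ZFSet.{u}) (hx : ∀ a ∈ x, a.IsOrdinal)
    (h : RelConstr.SeqLtOrd S ⊆ RelConstr.L x) :
    RelConstr.L x = Set.univ := by
  have hseq := exists_seq_mem_L hzero hone hne h
  have hord : ∀ o : Ordinal.{u}, o.toZFSet ∈ L x := fun o => by
    -- Length `o + 1` puts `o` itself into the domain of the sequence, and L[x] is transitive.
    obtain ⟨w, hwL, hw, -⟩ := hseq (o + 1) fun _ => True
    obtain ⟨s, hs⟩ := hw o.toZFSet (Ordinal.toZFSet_mem_toZFSet_iff.2 (lt_add_one o))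
    exact (mem_L_of_pair_mem (mem_L_of_mem hwL hs)).1
  have honeL : one ∈ L x := by
    obtain ⟨w, hwL, -, hw⟩ := hseq 1 fun _ => True
    have hs := (hw (Ordinal.toZFSet 0)).2
      ⟨Ordinal.toZFSet_mem_toZFSet_iff.2 zero_lt_one, trivial⟩
    exact (mem_L_of_pair_mem (mem_L_of_mem hwL hs)).2
  refine Set.eq_univ_of_forall fun y => ?_
  obtain ⟨κ, π, ⟨b₀, hb₀, rfl⟩, hπ⟩ := exists_enumeration y
  have hD := prod_mem_L (hord κ)
  obtain ⟨G, hGL, hG⟩ := exists_collapse_graph (lexRel_mem_L (hord κ)) hD (mem_pairCode κ)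
  obtain ⟨w, hwL, -, hw⟩ := hseq (κ * κ) fun z => ∃ ξ < κ, ∃ η < κ, z = (κ * ξ + η).toZFSet ∧
    π ξ.toZFSet ∈ π η.toZFSet
  let R := (ZFSet.prod κ.toZFSet κ.toZFSet).sep fun p =>
    ∃ z, ZFSet.pair p z ∈ G ∧ ZFSet.pair z one ∈ w
  have hR : ∀ a b, ZFSet.pair a b ∈ R ↔ a ∈ κ.toZFSet ∧ b ∈ κ.toZFSet ∧ π a ∈ π b := by
    intro a b
    rw [ZFSet.mem_sep, ZFSet.pair_mem_prod, and_assoc]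
    refine and_congr_right fun ha => and_congr_right fun hb => ?_
    obtain ⟨ξ, hξ, rfl⟩ := Ordinal.mem_toZFSet_iff.1 ha
    obtain ⟨η, hη, rfl⟩ := Ordinal.mem_toZFSet_iff.1 hb
    simp only [hG, pairCode_pair hξ hη, hw]
    constructor
    · rintro ⟨z, ⟨_, rfl⟩, _, ξ', hξ', η', hη', h, hmem⟩
      obtain ⟨rfl, rfl⟩ := mul_add_inj hη' hη (Ordinal.toZFSet_injective h)
      exact hmem
    · intro hmem
      refine ⟨_, ⟨ZFSet.pair_mem_prod.2 ⟨ha, hb⟩, rfl⟩, Ordinal.toZFSet_mem_toZFSet_iff.2 ?_,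
        ξ, hξ, η, hη, rfl, hmem⟩
      -- The bound κξ + η < κ·κ is the lexicographic comparison of (ξ, η) with (κ, 0).
      simpa using (mul_add_lt_iff (ξ := κ) (ξ' := ξ) (pos_of_gt hη) hη).2 (.inl hξ)
  have hRL : R ∈ L x := by
    refine mem_L_of_definable {ZFSet.prod κ.toZFSet κ.toZFSet, G, w, one}
      (by simp [hD, hGL, hwL, honeL]) (fun p hp => mem_L_of_mem hD (ZFSet.mem_sep.1 hp).1)
      fun M hM hc _ => ?_
    have hGM : G ∈ M := hc G (by simp)
    have hd : DefOver x M (fun v : Fin 1 → ZFSet => v 0 ∈ ZFSet.prod κ.toZFSet κ.toZFSet ∧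
        ∃ z ∈ M, ZFSet.pair (v 0) z ∈ G ∧ ZFSet.pair z one ∈ w) :=
      (DefOver.mem (.var _) (.const (hc _ (by simp)))).and
        (.ex ((DefOver.pair_mem hM (.const hGM) (.var _) (.var _)).and
        (.pair_mem hM (.const (hc w (by simp))) (.var _) (.const (hc one (by simp))))))
    refine hd.congr fun v _ => ?_
    rw [ZFSet.mem_sep]
    refine and_congr_right fun _ => ⟨?_, fun ⟨z, _, hz⟩ => ⟨z, hz⟩⟩
    rintro ⟨z, hz⟩
    exact ⟨z, (mem_of_pair_mem hM (hM _ hGM hz.1)).2, hz⟩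
  obtain ⟨F, hFL, hF⟩ := exists_collapse_graph (π := π) hRL (hord κ) fun b z => by
    rw [hπ b z]
    simp only [hR]
    exact ⟨fun ⟨hb, a, ha, h, hz⟩ => ⟨a, ⟨ha, hb, h⟩, hz⟩,
      fun ⟨a, ⟨ha, hb, h⟩, hz⟩ => ⟨hb, a, ha, h, hz⟩⟩
  exact (mem_L_of_pair_mem (mem_L_of_mem hFL ((hF b₀ _).2 ⟨hb₀, rfl⟩))).2
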